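/- Let $n\ge 2$ be an integer and $N=2n+1$. Let $C^*(F_m)$ denote the full $C^*$-algebra of the free group $F_m$ on $m$ generators, and let $V_1,\dots,V_n$ and $W_1,\dots,W_{2n}$ be the canonical unitary generators of $C^*(F_n)$ and of $C^*(F_{2n})$. Let $\mathcal X$ be the linear span of $1\otimes 1$, $V_1\otimes 1,\dots,V_n\otimes 1$, $1\otimes V_1,\dots,1\otimes V_n$ in the algebraic tensor product $C^*(F_n)\otimes C^*(F_n)$. Then: (1) $\dim\mathcal X=N$. (2) There is a linear isomorphism $\Phi$ from $\mathcal X$ onto the span of $1,W_1,\dots,W_{2n}$ in $C^*(F_{2n})$ with $\Phi(1\otimes 1)=1$, $\Phi(V_i\otimes 1)=W_i$ and $\Phi(1\otimes V_i)=W_{n+i}$ for $1\le i\le n$ (it is unique, since these elements span $\mathcal X$). For $k\ge 1$ and $X\in \mathcal X\otimes M_k(\mathbb C)=M_k(\mathcal X)$, let $\|X\|_{\min}$ and $\|X\|_{\max}$ be the norms of $X$ in the $C^*$-algebras $(C^*(F_n)\otimes_{\min}C^*(F_n))\otimes M_k(\mathbb C)$ and $(C^*(F_n)\otimes_{\max}C^*(F_n))\otimes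 M_k(\mathbb C)$, and let $\|X\|_{C^*(F_{2n})}$ be the norm of $(\Phi\otimes\mathrm{id})(X)$ in $C^*(F_{2n})\otimes M_k(\mathbb C)$. Then for all $k\ge1$ and all $X\in\mathcal X\otimes M_k(\mathbb C)$, $$\|X\|_{\min}\le\|X\|_{\max}\le\|X\|_{C^*(F_{2n})}\le (N^2-N)^{1/2}\,\|X\|_{\min}.$$ (3) Let $\mathcal X_{\max}$ and $\mathcal X_{\min}$ be the images of $\mathcal X$ in $C^*(F_n)\otimes_{\max}C^*(F_n)$ and $C^*(F_n)\otimes_{\min}C^*(F_n)$, regarded as operator spaces, and let $\delta_{cb}(E,F)=\inf\{\|u\|_{cb}\|u^{-1}\|_{cb}\}$, the infimum over all linear isomorphisms $u:E\to F$. Then $\delta_{cb}(\mathcal X_{\max},\mathcal X_{\min})\le (N^2-N)^{1/2}$. -/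

import Mathlib

open scoped TensorProduct ENNReal
open UniformSpace

noncomputable section

universe u

/-! ### Unital `*`-representations on Hilbert spaces -/

/-- A unital `*`-representation of a unital complex `*`-algebra on a complex Hilbert space.  The
Hilbert space lives in the universe of the algebra; this is enough for every cyclic
representation. -/
structure StarRep (A : Type u) [Ring A] [StarRing A] [Algebra ℂ A] where
  /-- the Hilbert space -/
  H : Type u
  [normedH : NormedAddCommGroup H]
  [innerH : InnerProductSpace ℂ H]
  [completeH : CompleteSpace H]
  /-- the representation -/
  π : A →⋆ₐ[ℂ] (H →L[ℂ] H)

attribute [instance] StarRep.normedH StarRep.innerH StarRep.completeH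

/-- A family `S` of `*`-representations is pointwise bounded if `sup_{π ∈ S} ‖π x‖ < ∞` for
all `x`. -/
class StarRep.BoundedFamily {A : Type u} [Ring A] [StarRing A] [Algebra ℂ A]
    (S : Set (StarRep A)) : Prop where
  bdd : ∀ x : A, BddAbove (Set.range fun ρ : S => ‖ρ.1.π x‖)

/-- The C*-seminorm `x ↦ sup_{π ∈ S} ‖π x‖`. -/
def StarRep.supNorm {A : Type u} [Ring A] [StarRing A] [Algebra ℂ A]
    (S : Set (StarRep A)) (x : A) : ℝ :=
  ⨆ ρ : S, ‖ρ.1.π x‖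

section SupNorm

variable {A : Type u} [Ring A] [StarRing A] [Algebra ℂ A] (S : Set (StarRep A))

theorem StarRep.supNorm_nonneg (x : A) : 0 ≤ StarRep.supNorm S x :=
  Real.iSup_nonneg fun _ => norm_nonneg _

theorem StarRep.le_supNorm [StarRep.BoundedFamily S] (ρ : S) (x : A) :
    ‖ρ.1.π x‖ ≤ StarRep.supNorm S x :=
  le_ciSup (StarRep.BoundedFamily.bdd x) ρ

theorem StarRep.supNorm_le {x : A} {c : ℝ} (hc : 0 ≤ c) (h : ∀ ρ : S, ‖ρ.1.π x‖ ≤ c) :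
    StarRep.supNorm S x ≤ c :=
  Real.iSup_le h hc

theorem StarRep.supNorm_mul_le [StarRep.BoundedFamily S] (x y : A) :
    StarRep.supNorm S (x * y) ≤ StarRep.supNorm S x * StarRep.supNorm S y := by
  refine StarRep.supNorm_le S
    (mul_nonneg (StarRep.supNorm_nonneg S x) (StarRep.supNorm_nonneg S y)) fun ρ => ?_
  rw [map_mul]
  exact (norm_mul_le _ _).trans (mul_le_mul (StarRep.le_supNorm S ρ x)
    (StarRep.le_supNorm S ρ y) (norm_nonneg _) (StarRep.supNorm_nonneg S x))

theorem StarRep.supNorm_smul_le [StarRep.BoundedFamily S] (c : ℂ) (x : A) :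
    StarRep.supNorm S (c • x) ≤ ‖c‖ * StarRep.supNorm S x := by
  refine StarRep.supNorm_le S
    (mul_nonneg (norm_nonneg c) (StarRep.supNorm_nonneg S x)) fun ρ => ?_
  rw [map_smul, norm_smul]
  exact mul_le_mul_of_nonneg_left (StarRep.le_supNorm S ρ x) (norm_nonneg c)

theorem StarRep.supNorm_star (x : A) : StarRep.supNorm S (star x) = StarRep.supNorm S x := by
  simp [StarRep.supNorm, map_star]

theorem StarRep.supNorm_sq_le [StarRep.BoundedFamily S] (x : A) :
    StarRep.supNorm S x * StarRep.supNorm S x ≤ StarRep.supNorm S (star x * x) := by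
  have h : StarRep.supNorm S x ≤ Real.sqrt (StarRep.supNorm S (star x * x)) := by
    refine StarRep.supNorm_le S (Real.sqrt_nonneg _) fun ρ => Real.le_sqrt_of_sq_le ?_
    refine le_trans (le_of_eq ?_) (StarRep.le_supNorm S ρ (star x * x))
    rw [map_mul, map_star, CStarRing.norm_star_mul_self, sq]
  calc StarRep.supNorm S x * StarRep.supNorm S x
      ≤ Real.sqrt (StarRep.supNorm S (star x * x)) * Real.sqrt (StarRep.supNorm S (star x * x)) :=
        mul_self_le_mul_self (StarRep.supNorm_nonneg S x) h
    _ = _ := Real.mul_self_sqrt (StarRep.supNorm_nonneg S _)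

/-- `StarRep.supNorm S` as a ring seminorm. -/
def StarRep.ringSeminorm [StarRep.BoundedFamily S] : RingSeminorm A where
  toFun := StarRep.supNorm S
  map_zero' := by simp [StarRep.supNorm]
  add_le' x y := by
    refine StarRep.supNorm_le S
      (add_nonneg (StarRep.supNorm_nonneg S x) (StarRep.supNorm_nonneg S y)) fun ρ => ?_
    rw [map_add]
    exact (norm_add_le _ _).trans
      (add_le_add (StarRep.le_supNorm S ρ x) (StarRep.le_supNorm S ρ y))
  neg' x := by simp [StarRep.supNorm]
  mul_le' := StarRep.supNorm_mul_le S

end SupNorm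

/-! ### The C*-algebra generated by a family of representations -/

/-- The `*`-algebra `A`, regarded as a seminormed algebra with the seminorm
`x ↦ sup_{π ∈ S} ‖π x‖`. -/
def PreEnvelope {A : Type u} [Ring A] [StarRing A] [Algebra ℂ A] (_S : Set (StarRep A)) :
    Type u := A

/-- The separated completion of the `*`-algebra `A` for the C*-seminorm
`x ↦ sup_{π ∈ S} ‖π x‖`. -/
def CStarEnvelope {A : Type u} [Ring A] [StarRing A] [Algebra ℂ A] (S : Set (StarRep A))
    [StarRep.BoundedFamily S] : Type u :=
  letI : SeminormedRing (PreEnvelope S) := (StarRep.ringSeminorm S).toSeminormedRing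
  Completion (PreEnvelope S)

section Envelope

variable {A : Type u} [Ring A] [StarRing A] [Algebra ℂ A] (S : Set (StarRep A))
  [StarRep.BoundedFamily S]

instance PreEnvelope.instSeminormedRing : SeminormedRing (PreEnvelope S) :=
  (StarRep.ringSeminorm S).toSeminormedRing

instance PreEnvelope.instStarRing : StarRing (PreEnvelope S) :=
  inferInstanceAs (StarRing A)

instance PreEnvelope.instNormedAlgebra : NormedAlgebra ℂ (PreEnvelope S) where
  __ := (inferInstanceAs (Algebra ℂ A) : Algebra ℂ A)
  norm_smul_le := StarRep.supNorm_smul_le S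

theorem PreEnvelope.norm_star (x : PreEnvelope S) : ‖star x‖ = ‖x‖ :=
  StarRep.supNorm_star S x

theorem PreEnvelope.norm_sq_le (x : PreEnvelope S) : ‖x‖ * ‖x‖ ≤ ‖star x * x‖ :=
  StarRep.supNorm_sq_le S x

theorem PreEnvelope.uniformContinuous_star :
    UniformContinuous (star : PreEnvelope S → PreEnvelope S) :=
  (AddMonoidHomClass.isometry_of_norm (starAddEquiv : PreEnvelope S ≃+ PreEnvelope S)
    (PreEnvelope.norm_star S)).uniformContinuous

instance CStarEnvelope.instNormedRing : NormedRing (CStarEnvelope S) :=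
  inferInstanceAs (NormedRing (Completion (PreEnvelope S)))

instance CStarEnvelope.instCompleteSpace : CompleteSpace (CStarEnvelope S) :=
  inferInstanceAs (CompleteSpace (Completion (PreEnvelope S)))

instance CStarEnvelope.instNormedAlgebra : NormedAlgebra ℂ (CStarEnvelope S) where
  __ := (inferInstanceAs (Algebra ℂ (Completion (PreEnvelope S))) :
    Algebra ℂ (Completion (PreEnvelope S)))
  norm_smul_le := (inferInstanceAs (NormedSpace ℂ (Completion (PreEnvelope S))) :
    NormedSpace ℂ (Completion (PreEnvelope S))).norm_smul_le

instance CStarEnvelope.instStar : Star (CStarEnvelope S) where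
  star := (Completion.map (star : PreEnvelope S → PreEnvelope S) :
    Completion (PreEnvelope S) → Completion (PreEnvelope S))

/-- The canonical map from the `*`-algebra to its completion. -/
def CStarEnvelope.coe (x : A) : CStarEnvelope S :=
  Completion.coe' (α := PreEnvelope S) x

theorem CStarEnvelope.induction {p : CStarEnvelope S → Prop} (x : CStarEnvelope S)
    (hp : IsClosed {x | p x}) (h : ∀ a : A, p (CStarEnvelope.coe S a)) : p x :=
  Completion.induction_on (α := PreEnvelope S) x hp h

theorem CStarEnvelope.continuous_star : Continuous (star : CStarEnvelope S → CStarEnvelope S) :=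
  Completion.continuous_map (α := PreEnvelope S) (β := PreEnvelope S)

theorem CStarEnvelope.star_coe (x : A) :
    star (CStarEnvelope.coe S x) = CStarEnvelope.coe S (star x) :=
  Completion.map_coe (PreEnvelope.uniformContinuous_star S) x

theorem CStarEnvelope.coe_add (x y : A) :
    CStarEnvelope.coe S (x + y) = CStarEnvelope.coe S x + CStarEnvelope.coe S y :=
  Completion.coe_add (α := PreEnvelope S) x y

theorem CStarEnvelope.coe_mul (x y : A) :
    CStarEnvelope.coe S (x * y) = CStarEnvelope.coe S x * CStarEnvelope.coe S y :=
  Completion.coe_mul (α := PreEnvelope S) x y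

theorem CStarEnvelope.coe_smul (c : ℂ) (x : A) :
    CStarEnvelope.coe S (c • x) = c • CStarEnvelope.coe S x :=
  Completion.coe_smul (M := ℂ) (X := PreEnvelope S) c x

theorem CStarEnvelope.coe_one : CStarEnvelope.coe S (1 : A) = 1 :=
  Completion.coe_one (PreEnvelope S)

theorem CStarEnvelope.norm_coe (x : A) : ‖CStarEnvelope.coe S x‖ = StarRep.supNorm S x :=
  Completion.norm_coe (E := PreEnvelope S) x

instance CStarEnvelope.instStarRing : StarRing (CStarEnvelope S) where
  star_involutive x := by
    have hs := CStarEnvelope.continuous_star S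
    refine CStarEnvelope.induction S (p := fun x => star (star x) = x) x ?_ fun a => ?_
    · exact isClosed_eq (hs.comp hs) continuous_id
    · simp only [CStarEnvelope.star_coe, star_star]
  star_mul x y := by
    have hs := CStarEnvelope.continuous_star S
    refine CStarEnvelope.induction S (p := fun x => star (x * y) = star y * star x) x ?_
      fun a => ?_
    · exact isClosed_eq (hs.comp (continuous_mul_const y)) ((continuous_const_mul _).comp hs)
    refine CStarEnvelope.induction S (p := fun y => star (CStarEnvelope.coe S a * y) =
      star y * star (CStarEnvelope.coe S a)) y ?_ fun b => ?_
    · exact isClosed_eq (hs.comp (continuous_const_mul _)) ((continuous_mul_const _).comp hs)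
    · simp only [← CStarEnvelope.coe_mul, CStarEnvelope.star_coe, star_mul]
  star_add x y := by
    have hs := CStarEnvelope.continuous_star S
    refine CStarEnvelope.induction S (p := fun x => star (x + y) = star x + star y) x ?_
      fun a => ?_
    · exact isClosed_eq (hs.comp (continuous_add_const y)) ((continuous_add_const _).comp hs)
    refine CStarEnvelope.induction S (p := fun y => star (CStarEnvelope.coe S a + y) =
      star (CStarEnvelope.coe S a) + star y) y ?_ fun b => ?_
    · exact isClosed_eq (hs.comp (continuous_const_add _)) ((continuous_const_add _).comp hs)
    · simp only [← CStarEnvelope.coe_add, CStarEnvelope.star_coe, star_add]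

instance CStarEnvelope.instStarModule [StarModule ℂ A] : StarModule ℂ (CStarEnvelope S) where
  star_smul c x := by
    have hs := CStarEnvelope.continuous_star S
    refine CStarEnvelope.induction S (p := fun x => star (c • x) = star c • star x) x ?_
      fun a => ?_
    · exact isClosed_eq (hs.comp (continuous_const_smul c)) ((continuous_const_smul _).comp hs)
    · simp only [← CStarEnvelope.coe_smul, CStarEnvelope.star_coe, star_smul]

instance CStarEnvelope.instCStarRing : CStarRing (CStarEnvelope S) where
  norm_mul_self_le x := by
    have hs := CStarEnvelope.continuous_star S
    refine CStarEnvelope.induction S (p := fun x => ‖x‖ * ‖x‖ ≤ ‖star x * x‖) x ?_ fun a => ?_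
    · exact isClosed_le (continuous_norm.mul continuous_norm)
        (continuous_norm.comp (hs.mul continuous_id))
    · rw [CStarEnvelope.star_coe, ← CStarEnvelope.coe_mul, CStarEnvelope.norm_coe,
        CStarEnvelope.norm_coe]
      exact StarRep.supNorm_sq_le S a

instance CStarEnvelope.instCStarAlgebra [StarModule ℂ A] : CStarAlgebra (CStarEnvelope S) where

/-- The canonical unital `*`-homomorphism from the `*`-algebra to its completion. -/
def CStarEnvelope.ι : A →⋆ₐ[ℂ] CStarEnvelope S where
  toFun := CStarEnvelope.coe S
  map_one' := CStarEnvelope.coe_one S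
  map_mul' := CStarEnvelope.coe_mul S
  map_zero' := Completion.coe_zero (α := PreEnvelope S)
  map_add' := CStarEnvelope.coe_add S
  commutes' c := by
    rw [Algebra.algebraMap_eq_smul_one, Algebra.algebraMap_eq_smul_one,
      CStarEnvelope.coe_smul, CStarEnvelope.coe_one]
  map_star' x := (CStarEnvelope.star_coe S x).symm

end Envelope

/-! ### The full C*-algebra of a group -/

section GroupAlgebra

variable {G : Type u} [Group G]

/-- The involution of the group algebra: `(∑ c_g g)^* = ∑ conj(c_g) g⁻¹`. -/
instance groupAlgebraStar : Star (MonoidAlgebra ℂ G) where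
  star x := MonoidAlgebra.ofCoeff
    ((x.coeff.mapRange star (star_zero ℂ)).equivMapDomain (Equiv.inv G))

theorem groupAlgebra_star_apply (x : MonoidAlgebra ℂ G) (g : G) :
    (star x).coeff g = star (x.coeff g⁻¹) := rfl

theorem groupAlgebra_star_add (x y : MonoidAlgebra ℂ G) : star (x + y) = star x + star y := by
  ext g
  simp [groupAlgebra_star_apply]

theorem groupAlgebra_star_single (g : G) (c : ℂ) :
    star (MonoidAlgebra.single g c) = MonoidAlgebra.single g⁻¹ (star c) := by
  classical
  ext h
  rw [groupAlgebra_star_apply, MonoidAlgebra.coeff_single, MonoidAlgebra.coeff_single,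
    Finsupp.single_apply, Finsupp.single_apply]
  by_cases hg : g = h⁻¹
  · simp [hg]
  · have hg' : g⁻¹ ≠ h := fun h' => hg (by rw [← h', inv_inv])
    simp [hg, hg']

instance groupAlgebraStarRing : StarRing (MonoidAlgebra ℂ G) where
  star_involutive x := by
    ext g
    simp [groupAlgebra_star_apply]
  star_add := groupAlgebra_star_add
  star_mul x y := by
    induction x using MonoidAlgebra.induction_linear with
    | zero =>
      have h0 : star (0 : MonoidAlgebra ℂ G) = 0 := by
        ext g
        simp [groupAlgebra_star_apply]
      simp [h0]
    | add x₁ x₂ h₁ h₂ => rw [add_mul, groupAlgebra_star_add, h₁, h₂, groupAlgebra_star_add, mul_add]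
    | single g c =>
      induction y using MonoidAlgebra.induction_linear with
      | zero =>
        have h0 : star (0 : MonoidAlgebra ℂ G) = 0 := by
          ext g
          simp [groupAlgebra_star_apply]
        simp [h0]
      | add y₁ y₂ h₁ h₂ =>
        rw [mul_add, groupAlgebra_star_add, h₁, h₂, groupAlgebra_star_add, add_mul]
      | single h d =>
        simp [groupAlgebra_star_single, MonoidAlgebra.single_mul_single, mul_comm]

instance groupAlgebraStarModule : StarModule ℂ (MonoidAlgebra ℂ G) where
  star_smul c x := by
    ext g
    simp [groupAlgebra_star_apply]

/-- Group elements are represented by contractions (indeed unitaries). -/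
theorem StarRep.norm_single_le (ρ : StarRep (MonoidAlgebra ℂ G)) (g : G) :
    ‖ρ.π (MonoidAlgebra.single g 1)‖ ≤ 1 := by
  have h : star (ρ.π (MonoidAlgebra.single g 1)) * ρ.π (MonoidAlgebra.single g 1) = 1 := by
    rw [← map_star, ← map_mul, groupAlgebra_star_single, MonoidAlgebra.single_mul_single,
      inv_mul_cancel, star_one, mul_one, ← MonoidAlgebra.one_def, map_one]
  have h2 := CStarRing.norm_star_mul_self (x := ρ.π (MonoidAlgebra.single g 1))
  rw [h] at h2
  have h3 : ‖(1 : ρ.H →L[ℂ] ρ.H)‖ ≤ 1 := ContinuousLinearMap.norm_id_le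
  nlinarith [norm_nonneg (ρ.π (MonoidAlgebra.single g 1))]

instance groupAlgebra_boundedFamily (S : Set (StarRep (MonoidAlgebra ℂ G))) :
    StarRep.BoundedFamily S where
  bdd x := by
    suffices h : ∃ C, ∀ ρ : StarRep (MonoidAlgebra ℂ G), ‖ρ.π x‖ ≤ C by
      obtain ⟨C, hC⟩ := h
      exact ⟨C, by rintro _ ⟨ρ, rfl⟩; exact hC ρ.1⟩
    induction x using MonoidAlgebra.induction_on with
    | of g => exact ⟨1, fun ρ => ρ.norm_single_le g⟩
    | add x y hx hy =>
      obtain ⟨C, hC⟩ := hx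
      obtain ⟨D, hD⟩ := hy
      exact ⟨C + D, fun ρ => by
        rw [map_add]; exact (norm_add_le _ _).trans (add_le_add (hC ρ) (hD ρ))⟩
    | smul c x hx =>
      obtain ⟨C, hC⟩ := hx
      exact ⟨‖c‖ * C, fun ρ => by
        rw [map_smul, norm_smul]; exact mul_le_mul_of_nonneg_left (hC ρ) (norm_nonneg c)⟩

end GroupAlgebra

/-- The full C*-algebra `C*(G)` of a discrete group: the completion of the group algebra `ℂ[G]` for
the norm `sup ‖π x‖` over all `*`-representations (equivalently, unitary representations of `G`). -/
abbrev FullGroupCStar (G : Type u) [Group G] : Type u :=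
  CStarEnvelope (Set.univ : Set (StarRep (MonoidAlgebra ℂ G)))

/-- The canonical unitary of `C*(G)` given by a group element. -/
def FullGroupCStar.of {G : Type u} [Group G] (g : G) : FullGroupCStar G :=
  CStarEnvelope.ι Set.univ (MonoidAlgebra.single g 1)

/-! ### The maximal and minimal C*-tensor products -/

section TensorProducts

variable (A B : Type u) [CStarAlgebra A] [CStarAlgebra B]

instance tensor_boundedFamily (S : Set (StarRep (A ⊗[ℂ] B))) : StarRep.BoundedFamily S where
  bdd x := by
    suffices h : ∃ C, ∀ ρ : StarRep (A ⊗[ℂ] B), ‖ρ.π x‖ ≤ C by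
      obtain ⟨C, hC⟩ := h
      exact ⟨C, by rintro _ ⟨ρ, rfl⟩; exact hC ρ.1⟩
    induction x using TensorProduct.induction_on with
    | zero => exact ⟨0, fun ρ => by simp⟩
    | tmul a b =>
      refine ⟨‖a‖ * ‖b‖, fun ρ => ?_⟩
      let f : A →⋆ₐ[ℂ] (ρ.H →L[ℂ] ρ.H) :=
        { ρ.π.toAlgHom.comp (Algebra.TensorProduct.includeLeft : A →ₐ[ℂ] A ⊗[ℂ] B) with
          map_star' := fun a => by
            change ρ.π (star a ⊗ₜ[ℂ] (1 : B)) = star (ρ.π (a ⊗ₜ[ℂ] (1 : B)))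
            rw [← map_star, TensorProduct.star_tmul, star_one] }
      let g : B →⋆ₐ[ℂ] (ρ.H →L[ℂ] ρ.H) :=
        { ρ.π.toAlgHom.comp (Algebra.TensorProduct.includeRight : B →ₐ[ℂ] A ⊗[ℂ] B) with
          map_star' := fun b => by
            change ρ.π ((1 : A) ⊗ₜ[ℂ] star b) = star (ρ.π ((1 : A) ⊗ₜ[ℂ] b))
            rw [← map_star, TensorProduct.star_tmul, star_one] }
      have h : ρ.π (a ⊗ₜ[ℂ] b) = f a * g b := by
        change _ = ρ.π (a ⊗ₜ[ℂ] (1 : B)) * ρ.π ((1 : A) ⊗ₜ[ℂ] b)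
        rw [← map_mul, Algebra.TensorProduct.tmul_mul_tmul, mul_one, one_mul]
      rw [h]
      exact (norm_mul_le _ _).trans (mul_le_mul (NonUnitalStarAlgHom.norm_apply_le f a)
        (NonUnitalStarAlgHom.norm_apply_le g b) (norm_nonneg _) (norm_nonneg _))
    | add x y hx hy =>
      obtain ⟨C, hC⟩ := hx
      obtain ⟨D, hD⟩ := hy
      exact ⟨C + D, fun ρ => by
        rw [map_add]; exact (norm_add_le _ _).trans (add_le_add (hC ρ) (hD ρ))⟩

/-- The maximal tensor product: the completion of the algebraic tensor product for
`‖x‖_max = sup ‖π x‖`, the supremum over all `*`-representations of `A ⊗ B`. -/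
abbrev MaxTensor : Type u := CStarEnvelope (Set.univ : Set (StarRep (A ⊗[ℂ] B)))

end TensorProducts

section SpatialTensor

/-- The Hilbert space tensor product: the completion of the algebraic tensor product `H ⊗ K`. -/
def HilbertTensor (H K : Type u) [NormedAddCommGroup H] [InnerProductSpace ℂ H]
    [NormedAddCommGroup K] [InnerProductSpace ℂ K] : Type u :=
  Completion (H ⊗[ℂ] K)

variable {H K : Type u} [NormedAddCommGroup H] [InnerProductSpace ℂ H]
  [NormedAddCommGroup K] [InnerProductSpace ℂ K]

instance HilbertTensor.instNormedAddCommGroup : NormedAddCommGroup (HilbertTensor H K) :=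
  inferInstanceAs (NormedAddCommGroup (Completion (H ⊗[ℂ] K)))

instance HilbertTensor.instInnerProductSpace : InnerProductSpace ℂ (HilbertTensor H K) :=
  inferInstanceAs (InnerProductSpace ℂ (Completion (H ⊗[ℂ] K)))

instance HilbertTensor.instCompleteSpace : CompleteSpace (HilbertTensor H K) :=
  inferInstanceAs (CompleteSpace (Completion (H ⊗[ℂ] K)))

/-- The isometric inclusion of the algebraic tensor product. -/
def HilbertTensor.coe : H ⊗[ℂ] K →ₗᵢ[ℂ] HilbertTensor H K :=
  (Completion.toComplₗᵢ : H ⊗[ℂ] K →ₗᵢ[ℂ] Completion (H ⊗[ℂ] K))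

theorem HilbertTensor.induction {p : HilbertTensor H K → Prop} (x : HilbertTensor H K)
    (hp : IsClosed {x | p x}) (h : ∀ v : H ⊗[ℂ] K, p (HilbertTensor.coe v)) : p x :=
  Completion.induction_on (α := H ⊗[ℂ] K) x hp h

/-- The operator `S ⊗ T` on the Hilbert space tensor product. -/
def hilbertTensorMap (S : H →L[ℂ] H) (T : K →L[ℂ] K) :
    HilbertTensor H K →L[ℂ] HilbertTensor H K :=
  ((TensorProduct.mapL S T).completion :
    Completion (H ⊗[ℂ] K) →L[ℂ] Completion (H ⊗[ℂ] K))

theorem hilbertTensorMap_coe (S : H →L[ℂ] H) (T : K →L[ℂ] K) (v : H ⊗[ℂ] K) :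
    hilbertTensorMap S T (HilbertTensor.coe v) =
      HilbertTensor.coe (TensorProduct.mapL S T v) :=
  ContinuousLinearMap.completion_apply_coe (TensorProduct.mapL S T) v

theorem hilbertTensor_ext {P Q : HilbertTensor H K →L[ℂ] HilbertTensor H K}
    (h : ∀ (x : H) (y : K), P (HilbertTensor.coe (x ⊗ₜ y)) = Q (HilbertTensor.coe (x ⊗ₜ y))) :
    P = Q := by
  ext z
  refine HilbertTensor.induction (p := fun z => P z = Q z) z
    (isClosed_eq P.continuous Q.continuous) fun v => ?_
  induction v using TensorProduct.induction_on with
  | zero => simp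
  | add v₁ v₂ h₁ h₂ => simp only [map_add, h₁, h₂]
  | tmul x y => exact h x y

theorem hilbertTensorMap_tmul (S : H →L[ℂ] H) (T : K →L[ℂ] K) (x : H) (y : K) :
    hilbertTensorMap S T (HilbertTensor.coe (x ⊗ₜ[ℂ] y)) =
      HilbertTensor.coe (S x ⊗ₜ[ℂ] T y) := by
  rw [hilbertTensorMap_coe, TensorProduct.mapL_tmul]

theorem hilbertTensorMap_adjoint [CompleteSpace H] [CompleteSpace K]
    (S : H →L[ℂ] H) (T : K →L[ℂ] K) :
    hilbertTensorMap (star S) (star T) = star (hilbertTensorMap S T) := by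
  rw [ContinuousLinearMap.star_eq_adjoint (hilbertTensorMap S T),
    ContinuousLinearMap.eq_adjoint_iff]
  intro x y
  refine HilbertTensor.induction (p := fun x => inner ℂ (hilbertTensorMap (star S) (star T) x) y =
    inner ℂ x (hilbertTensorMap S T y)) x (isClosed_eq (by fun_prop) (by fun_prop)) fun v => ?_
  refine HilbertTensor.induction (p := fun y => inner ℂ (hilbertTensorMap (star S) (star T)
    (HilbertTensor.coe v)) y = inner ℂ (HilbertTensor.coe v) (hilbertTensorMap S T y)) y
    (isClosed_eq (by fun_prop) (by fun_prop)) fun w => ?_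
  rw [hilbertTensorMap_coe, hilbertTensorMap_coe, LinearIsometry.inner_map_map,
    LinearIsometry.inner_map_map]
  induction v using TensorProduct.induction_on with
  | zero => simp
  | add v₁ v₂ h₁ h₂ => simp only [map_add, inner_add_left, h₁, h₂]
  | tmul a b =>
    induction w using TensorProduct.induction_on with
    | zero => simp
    | add w₁ w₂ h₁ h₂ => simp only [map_add, inner_add_right, h₁, h₂]
    | tmul c d =>
      simp only [TensorProduct.mapL_tmul, TensorProduct.inner_tmul,
        ContinuousLinearMap.star_eq_adjoint, ContinuousLinearMap.adjoint_inner_left]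

end SpatialTensor

section MinTensor

variable {A B : Type u} [CStarAlgebra A] [CStarAlgebra B]

/-- The linear map `a ⊗ b ↦ ρ(a) ⊗ σ(b)`. -/
def StarRep.tensorLinear (ρ : StarRep A) (σ : StarRep B) :
    A ⊗[ℂ] B →ₗ[ℂ] (HilbertTensor ρ.H σ.H →L[ℂ] HilbertTensor ρ.H σ.H) :=
  TensorProduct.lift <| LinearMap.mk₂ ℂ (fun a b => hilbertTensorMap (ρ.π a) (σ.π b))
    (fun a a' b => hilbertTensor_ext fun x y => by
      simp [hilbertTensorMap_tmul, TensorProduct.add_tmul])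
    (fun c a b => hilbertTensor_ext fun x y => by
      simp [hilbertTensorMap_tmul, ← TensorProduct.smul_tmul'])
    (fun a b b' => hilbertTensor_ext fun x y => by
      simp [hilbertTensorMap_tmul, TensorProduct.tmul_add])
    (fun c a b => hilbertTensor_ext fun x y => by
      simp [hilbertTensorMap_tmul])

theorem StarRep.tensorLinear_tmul (ρ : StarRep A) (σ : StarRep B) (a : A) (b : B) :
    ρ.tensorLinear σ (a ⊗ₜ[ℂ] b) = hilbertTensorMap (ρ.π a) (σ.π b) := rfl

theorem StarRep.tensorLinear_star (ρ : StarRep A) (σ : StarRep B) (x : A ⊗[ℂ] B) :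
    ρ.tensorLinear σ (star x) = star (ρ.tensorLinear σ x) := by
  induction x using TensorProduct.induction_on with
  | zero => simp
  | add x y hx hy => rw [star_add, map_add, map_add, star_add, hx, hy]
  | tmul a b =>
    rw [TensorProduct.star_tmul, StarRep.tensorLinear_tmul, StarRep.tensorLinear_tmul,
      map_star, map_star, hilbertTensorMap_adjoint]

/-- The tensor product representation `ρ ⊗ σ` of `A ⊗ B` on the Hilbert space tensor product. -/
def StarRep.tensor (ρ : StarRep A) (σ : StarRep B) : StarRep (A ⊗[ℂ] B) where
  H := HilbertTensor ρ.H σ.H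
  π :=
    { Algebra.TensorProduct.algHomOfLinearMapTensorProduct (ρ.tensorLinear σ)
        (fun a₁ a₂ b₁ b₂ => by
          refine hilbertTensor_ext fun x y => ?_
          change _ = ρ.tensorLinear σ (a₁ ⊗ₜ[ℂ] b₁)
            (ρ.tensorLinear σ (a₂ ⊗ₜ[ℂ] b₂) (HilbertTensor.coe (x ⊗ₜ[ℂ] y)))
          simp only [StarRep.tensorLinear_tmul, hilbertTensorMap_tmul, map_mul]
          rfl)
        (by
          refine hilbertTensor_ext fun x y => ?_
          simp only [StarRep.tensorLinear_tmul, hilbertTensorMap_tmul, map_one]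
          rfl) with
      map_star' := ρ.tensorLinear_star σ }

variable (A B) in
/-- The minimal (spatial) tensor product: the completion of the algebraic tensor product for
`‖x‖_min = sup ‖(ρ ⊗ σ) x‖`, the supremum over all pairs of representations `ρ` of `A` and `σ`
of `B`. -/
abbrev MinTensor : Type u :=
  CStarEnvelope (Set.range fun p : StarRep A × StarRep B => p.1.tensor p.2)

end MinTensor

/-! ### Matrix norms and the completely bounded distance -/

section OperatorSpaces

/-- The C*-norm on `M_k(A) = A ⊗ M_k(ℂ)` for a C*-algebra `A`.  (The order on `A` is the usual one
and enters only because Mathlib's norm on `CStarMatrix` asks for it.) -/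
def matrixNorm {A : Type u} [CStarAlgebra A] {k : ℕ} (M : Matrix (Fin k) (Fin k) A) : ℝ :=
  letI : PartialOrder A := CStarAlgebra.spectralOrder A
  letI : StarOrderedRing A := CStarAlgebra.spectralOrderedRing A
  ‖CStarMatrix.ofMatrix M‖

variable {A B : Type u} [CStarAlgebra A] [CStarAlgebra B]

/-- The completely bounded norm `sup_k ‖u ⊗ id_{M_k}‖` of a linear map between the operator spaces
`E ⊆ A` and `F ⊆ B`. -/
def cbNorm {E : Submodule ℂ A} {F : Submodule ℂ B} (u : E →ₗ[ℂ] F) : ℝ≥0∞ :=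
  ⨆ (k : ℕ) (X : Matrix (Fin k) (Fin k) E) (_ : matrixNorm (X.map fun x => (x : A)) ≤ 1),
    ENNReal.ofReal (matrixNorm (X.map fun x => (u x : B)))

/-- The multiplicative completely bounded distance
`δ_cb(E, F) = inf {‖u‖_cb ‖u⁻¹‖_cb : u : E → F a linear isomorphism}`. -/
def cbDist (E : Submodule ℂ A) (F : Submodule ℂ B) : ℝ≥0∞ :=
  ⨅ u : E ≃ₗ[ℂ] F, cbNorm u.toLinearMap * cbNorm u.symm.toLinearMap

end OperatorSpaces

/-! ### The space spanned by the generators -/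

section Generators

/-- `C*(F_m)`, the full C*-algebra of the free group on `m` generators. -/
abbrev CStarFree (m : ℕ) : Type := FullGroupCStar (FreeGroup (Fin m))

/-- The canonical unitary generators of `C*(F_m)`. -/
def freeGen {m : ℕ} (i : Fin m) : CStarFree m := FullGroupCStar.of (FreeGroup.of i)

variable (n : ℕ)

/-- The space `𝒳`, the span of `1 ⊗ 1`, `V_i ⊗ 1`, `1 ⊗ V_i` in the algebraic tensor product. -/
def genSpace : Submodule ℂ (CStarFree n ⊗[ℂ] CStarFree n) :=
  Submodule.span ℂ ({(1 : CStarFree n) ⊗ₜ[ℂ] (1 : CStarFree n)} ∪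
    (Set.range fun i : Fin n => freeGen i ⊗ₜ[ℂ] (1 : CStarFree n)) ∪
    (Set.range fun i : Fin n => (1 : CStarFree n) ⊗ₜ[ℂ] freeGen i))

/-- The element `1 ⊗ 1`. -/
def genSpace.unit : genSpace n :=
  ⟨(1 : CStarFree n) ⊗ₜ[ℂ] (1 : CStarFree n), Submodule.subset_span (Or.inl (Or.inl rfl))⟩

variable {n} in
/-- The element `V_i ⊗ 1`. -/
def genSpace.left (i : Fin n) : genSpace n :=
  ⟨freeGen i ⊗ₜ[ℂ] (1 : CStarFree n), Submodule.subset_span (Or.inl (Or.inr ⟨i, rfl⟩))⟩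

variable {n} in
/-- The element `1 ⊗ V_i`. -/
def genSpace.right (i : Fin n) : genSpace n :=
  ⟨(1 : CStarFree n) ⊗ₜ[ℂ] freeGen i, Submodule.subset_span (Or.inr ⟨i, rfl⟩)⟩

/-- The span of `1, W_1, …, W_{2n}` in `C*(F_{2n})`. -/
def freeGenSpace : Submodule ℂ (CStarFree (2 * n)) :=
  Submodule.span ℂ ({1} ∪ Set.range (freeGen : Fin (2 * n) → CStarFree (2 * n)))

variable {n} in
/-- `Φ` is the identification of `𝒳` with the span of `1, W_1, …, W_{2n}` that sends `1 ⊗ 1` to `1`,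
`V_i ⊗ 1` to `W_i` and `1 ⊗ V_i` to `W_{n+i}`. -/
def IsGenIdentification (Φ : genSpace n ≃ₗ[ℂ] freeGenSpace n) : Prop :=
  (Φ (genSpace.unit n) : CStarFree (2 * n)) = 1 ∧
  (∀ i : Fin n, (Φ (genSpace.left i) : CStarFree (2 * n)) =
    freeGen ⟨(i : ℕ), by have := i.isLt; omega⟩) ∧
  (∀ i : Fin n, (Φ (genSpace.right i) : CStarFree (2 * n)) =
    freeGen ⟨n + (i : ℕ), by have := i.isLt; omega⟩)

/-- The canonical map `C*(F_n) ⊗ C*(F_n) → C*(F_n) ⊗_max C*(F_n)`. -/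
def toMax : CStarFree n ⊗[ℂ] CStarFree n →⋆ₐ[ℂ] MaxTensor (CStarFree n) (CStarFree n) :=
  CStarEnvelope.ι _

/-- The canonical map `C*(F_n) ⊗ C*(F_n) → C*(F_n) ⊗_min C*(F_n)`. -/
def toMin : CStarFree n ⊗[ℂ] CStarFree n →⋆ₐ[ℂ] MinTensor (CStarFree n) (CStarFree n) :=
  CStarEnvelope.ι _

/-- The span of `1 ⊗ 1`, `V_i ⊗ 1`, `1 ⊗ V_i` as an operator space in the maximal tensor
product. -/
def genSpaceMax : Submodule ℂ (MaxTensor (CStarFree n) (CStarFree n)) :=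
  (genSpace n).map (toMax n).toAlgHom.toLinearMap

/-- The span of `1 ⊗ 1`, `V_i ⊗ 1`, `1 ⊗ V_i` as an operator space in the minimal tensor
product. -/
def genSpaceMin : Submodule ℂ (MinTensor (CStarFree n) (CStarFree n)) :=
  (genSpace n).map (toMin n).toAlgHom.toLinearMap

variable {n} {k : ℕ}

/-- The norm `‖X‖_max` of `X ∈ M_k(𝒳)`. -/
def normMax (X : Matrix (Fin k) (Fin k) (genSpace n)) : ℝ :=
  matrixNorm (X.map fun x => toMax n (x : CStarFree n ⊗[ℂ] CStarFree n))

/-- The norm `‖X‖_min` of `X ∈ M_k(𝒳)`. -/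
def normMin (X : Matrix (Fin k) (Fin k) (genSpace n)) : ℝ :=
  matrixNorm (X.map fun x => toMin n (x : CStarFree n ⊗[ℂ] CStarFree n))

/-- The norm `‖X‖_{C*(F_{2n})}` of `X ∈ M_k(𝒳)`, given the identification `Φ` of `𝒳` with the span
of `1, W_1, …, W_{2n}`. -/
def normFree (Φ : genSpace n ≃ₗ[ℂ] freeGenSpace n) (X : Matrix (Fin k) (Fin k) (genSpace n)) : ℝ :=
  matrixNorm (X.map fun x => (Φ x : CStarFree (2 * n)))

end Generators

end

/-! The two left inequalities come from `*`-homomorphisms, which are contractive on matrices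
(`matrixNorm_map_le`). Every `ρ ⊗ σ` is a representation of the algebraic tensor product, which
gives `maxToMin`. The unitaries `V_i ⊗ 1` and `1 ⊗ V_i` define a representation of the free group,
which gives `freeToMax`.

The right inequality compares both sides with the row norm `‖∑ a_l a_l^*‖^{1/2}` of the coefficients
of `X = ∑ a_l ⊗ x_l`, where `l` runs over `N` indices. If the `x_l` are unitaries, Cauchy–Schwarz
for a sum of `N` terms gives `‖∑ a_l ⊗ x_l‖² ≤ N ‖∑ a_l a_l^*‖` (`matrixNorm_coeffMatrix_sq_le`).
Conversely, if a contractive functional `φ` satisfies `φ (y_l y_m^*) = δ_{lm}`, then applying `φ` to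
the squared length of a row vector times `∑ a_l ⊗ y_l` removes the cross terms. This gives `‖∑ a_l
a_l^*‖ ≤ ‖∑ a_l ⊗ y_l‖²` (`sum_norm_sq_vecMul_le`, `norm_sum_mul_star_le`).

Such a functional exists already on the minimal tensor product. Let the generators of `F_n` act on
`ℓ²(ℤ/(n+1))` by the distinct nonzero translations; the vector state at `δ_0 ⊗ δ_0` then makes `1 ⊗
1`, `V_i ⊗ 1`, `1 ⊗ V_i` orthonormal (`isFunctionalOrthonormal_toMin_tensorGen`). Hence the free
norm is at most `√N` times the minimal norm, and `√N ≤ √(N² - N)`. The same orthonormality gives the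
linear independence behind the dimension and `Φ`. The bound on `δ_cb` follows by using the identity
of `𝒳` as the comparison map. -/

noncomputable section

/-! ### Extending `*`-homomorphisms to the envelope -/

section Lift

variable {A : Type u} [Ring A] [StarRing A] [Algebra ℂ A] {S : Set (StarRep A)}
  [StarRep.BoundedFamily S] {B : Type*} [CStarAlgebra B]

variable (S) in
/-- A `*`-homomorphism on `A`, regarded as a ring homomorphism on the seminormed algebra. -/
def PreEnvelope.ringHom (f : A →⋆ₐ[ℂ] B) : PreEnvelope S →+* B := f.toAlgHom.toRingHom

theorem PreEnvelope.continuous_ringHom (f : A →⋆ₐ[ℂ] B)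
    (hf : ∀ a, ‖f a‖ ≤ StarRep.supNorm S a) : Continuous (PreEnvelope.ringHom S f) :=
  AddMonoidHomClass.continuous_of_bound (PreEnvelope.ringHom S f) 1 fun a => by
    rw [one_mul]
    exact hf a

/-- The extension to the envelope of a `*`-homomorphism dominated by the C*-seminorm. -/
def CStarEnvelope.lift (f : A →⋆ₐ[ℂ] B) (hf : ∀ a, ‖f a‖ ≤ StarRep.supNorm S a) :
    CStarEnvelope S →⋆ₐ[ℂ] B :=
  let F : CStarEnvelope S →+* B := Completion.extensionHom _ (PreEnvelope.continuous_ringHom f hf)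
  have hF : ∀ a, F (CStarEnvelope.coe S a) = f a := fun a =>
    Completion.extensionHom_coe _ (PreEnvelope.continuous_ringHom f hf) a
  have hc : Continuous F := Completion.continuous_extension
  { F with
    commutes' := fun c => by
      change F (algebraMap ℂ _ c) = _
      rw [Algebra.algebraMap_eq_smul_one, ← CStarEnvelope.coe_one, ← CStarEnvelope.coe_smul, hF,
        map_smul, map_one, Algebra.algebraMap_eq_smul_one]
    map_star' := fun x => by
      change F (star x) = star (F x)
      refine CStarEnvelope.induction S (p := fun x => F (star x) = star (F x)) x ?_ fun a => ?_
      · exact isClosed_eq (hc.comp (CStarEnvelope.continuous_star S)) hc.star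
      · rw [CStarEnvelope.star_coe, hF, hF, map_star] }

theorem CStarEnvelope.lift_ι (f : A →⋆ₐ[ℂ] B) (hf : ∀ a, ‖f a‖ ≤ StarRep.supNorm S a) (a : A) :
    CStarEnvelope.lift f hf (CStarEnvelope.ι S a) = f a :=
  Completion.extensionHom_coe _ (PreEnvelope.continuous_ringHom f hf) a

end Lift

/-! ### Norms of matrices over a C*-algebra -/

section MatrixNorm

open scoped Matrix ComplexOrder

/-- Cauchy–Schwarz in the Hilbert `D`-module `D^ι`, applied to `z` and the constant vector `1`,
whose squared norm is at most `card ι`. -/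
theorem norm_sum_sq_le_card_mul {D ι : Type*} [CStarAlgebra D] [Fintype ι] (z : ι → D) :
    ‖∑ i, z i‖ ^ 2 ≤ Fintype.card ι * ‖∑ i, z i * star (z i)‖ := by
  let _ : PartialOrder D := CStarAlgebra.spectralOrder D
  have : StarOrderedRing D := CStarAlgebra.spectralOrderedRing D
  let e := WithCStarModule.equiv D (ι → D)
  have h := CStarModule.norm_inner_le (A := D) (x := e.symm fun _ => 1) (y := e.symm z)
  have h1 : ‖e.symm (fun _ : ι => (1 : D))‖ ^ 2 ≤ Fintype.card ι := by
    rw [WithCStarModule.pi_norm_sq]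
    refine (norm_sum_le _ _).trans ?_
    refine (Finset.sum_le_card_nsmul _ _ 1 fun i _ => ?_).trans (by simp)
    simp only [e, WithCStarModule.equiv_symm_pi_apply, WithCStarModule.inner_def, star_one, mul_one]
    rcases subsingleton_or_nontrivial D with _ | _
    · simp [Subsingleton.elim (1 : D) 0]
    · exact CStarRing.norm_one.le
  have h2 : ‖e.symm z‖ ^ 2 = ‖∑ i, z i * star (z i)‖ := by
    rw [WithCStarModule.pi_norm_sq]
    simp [e, WithCStarModule.inner_def]
  have h3 : ‖∑ i, z i‖ ≤ ‖e.symm (fun _ : ι => (1 : D))‖ * ‖e.symm z‖ := by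
    simpa [e, WithCStarModule.inner_def, WithCStarModule.pi_inner] using h
  calc ‖∑ i, z i‖ ^ 2 ≤ (‖e.symm (fun _ : ι => (1 : D))‖ * ‖e.symm z‖) ^ 2 := by gcongr
    _ = ‖e.symm (fun _ : ι => (1 : D))‖ ^ 2 * ‖e.symm z‖ ^ 2 := mul_pow _ _ _
    _ ≤ _ := by rw [h2]; gcongr

variable {A B : Type u} [CStarAlgebra A] [CStarAlgebra B] {k : ℕ} {ι : Type*} [Fintype ι]

theorem matrixNorm_nonneg (M : Matrix (Fin k) (Fin k) A) : 0 ≤ matrixNorm M :=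
  letI : PartialOrder A := CStarAlgebra.spectralOrder A
  letI : StarOrderedRing A := CStarAlgebra.spectralOrderedRing A
  norm_nonneg _

/-- Entrywise `*`-homomorphisms are contractive for the matrix norms. -/
theorem matrixNorm_map_le (f : A →⋆ₐ[ℂ] B) (M : Matrix (Fin k) (Fin k) A) :
    matrixNorm (M.map f) ≤ matrixNorm M := by
  let _ : PartialOrder A := CStarAlgebra.spectralOrder A
  have : StarOrderedRing A := CStarAlgebra.spectralOrderedRing A
  let _ : PartialOrder B := CStarAlgebra.spectralOrder B
  have : StarOrderedRing B := CStarAlgebra.spectralOrderedRing B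
  exact NonUnitalStarAlgHom.norm_apply_le
    (CStarMatrix.mapₙₐ (n := Fin k) (f : A →⋆ₙₐ[ℂ] B)) (CStarMatrix.ofMatrix M)

/-- The matrix `∑ l, a l ⊗ x l` with scalar matrices `a l` and elements `x l` of an algebra. -/
def coeffMatrix {V : Type*} [AddCommMonoid V] [Module ℂ V] (a : ι → Matrix (Fin k) (Fin k) ℂ)
    (x : ι → V) : Matrix (Fin k) (Fin k) V :=
  Matrix.of fun i j => ∑ l, a l i j • x l

theorem coeffMatrix_map {V W : Type*} [AddCommMonoid V] [Module ℂ V] [AddCommMonoid W]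
    [Module ℂ W] (a : ι → Matrix (Fin k) (Fin k) ℂ) (x : ι → V) (f : V →ₗ[ℂ] W) :
    (coeffMatrix a x).map f = coeffMatrix a fun l => f (x l) := by
  ext i j
  simp [coeffMatrix]

/-- If the `x l` are unitaries then `‖∑ a l ⊗ x l‖² ≤ card ι * ‖∑ (a l) (a l)^*‖`. -/
theorem matrixNorm_coeffMatrix_sq_le (a : ι → Matrix (Fin k) (Fin k) ℂ) (x : ι → A)
    (hx : ∀ l, x l * star (x l) = 1) :
    matrixNorm (coeffMatrix a x) ^ 2 ≤
      Fintype.card ι * ‖∑ l, CStarMatrix.ofMatrix (a l) * star (CStarMatrix.ofMatrix (a l))‖ := by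
  let _ : PartialOrder A := CStarAlgebra.spectralOrder A
  have : StarOrderedRing A := CStarAlgebra.spectralOrderedRing A
  let z : ι → CStarMatrix (Fin k) (Fin k) A := fun l =>
    CStarMatrix.ofMatrix (Matrix.of fun i j => a l i j • x l)
  have hz : CStarMatrix.ofMatrix (coeffMatrix a x) = ∑ l, z l := by
    ext i j
    simp only [z, coeffMatrix, CStarMatrix.ofMatrix_apply, Matrix.of_apply]
    exact (Matrix.sum_apply i j Finset.univ fun l => (Matrix.of fun i j => a l i j • x l)).symm
  -- Since `x l * star (x l) = 1`, the sum of the `z l * star (z l)` has scalar entries: it is the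
  -- image of `∑ (a l) (a l)^*` under `M_k(ℂ) → M_k(A)`, which is contractive.
  let g := CStarMatrix.mapₙₐ (n := Fin k) ((StarAlgHom.ofId ℂ A : ℂ →⋆ₐ[ℂ] A) : ℂ →⋆ₙₐ[ℂ] A)
  have hg : ∑ l, z l * star (z l) =
      g (∑ l, CStarMatrix.ofMatrix (a l) * star (CStarMatrix.ofMatrix (a l))) := by
    rw [map_sum]
    refine Finset.sum_congr rfl fun l _ => ?_
    rw [map_mul, map_star]
    ext i j
    rw [CStarMatrix.mul_apply, CStarMatrix.mul_apply]
    refine Finset.sum_congr rfl fun q _ => ?_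
    rw [CStarMatrix.star_apply, CStarMatrix.star_apply]
    change a l i q • x l * star (a l j q • x l) =
      algebraMap ℂ A (a l i q) * star (algebraMap ℂ A (a l j q))
    rw [star_smul, smul_mul_smul_comm, hx, ← algebraMap_star_comm, ← map_mul,
      Algebra.algebraMap_eq_smul_one]
  calc matrixNorm (coeffMatrix a x) ^ 2 = ‖∑ l, z l‖ ^ 2 := by rw [← hz]; rfl
    _ ≤ Fintype.card ι * ‖∑ l, z l * star (z l)‖ := norm_sum_sq_le_card_mul z
    _ ≤ _ := by
      rw [hg]
      gcongr
      exact NonUnitalStarAlgHom.norm_apply_le g _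

/-- A contractive functional `φ` for which the `x l` are orthonormal gives a lower bound for the
rows of `∑ a l ⊗ x l`. -/
theorem sum_norm_sq_vecMul_le [DecidableEq ι] (a : ι → Matrix (Fin k) (Fin k) ℂ) (x : ι → A)
    (φ : A →ₗ[ℂ] ℂ) (hφ : ∀ b, ‖φ b‖ ≤ ‖b‖)
    (hx : ∀ l m, φ (x l * star (x m)) = if l = m then 1 else 0) (v : Fin k → ℂ) :
    ∑ l, ∑ j, ‖(v ᵥ* a l) j‖ ^ 2 ≤ matrixNorm (coeffMatrix a x) ^ 2 * ∑ i, ‖v i‖ ^ 2 := by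
  let _ : PartialOrder A := CStarAlgebra.spectralOrder A
  have : StarOrderedRing A := CStarAlgebra.spectralOrderedRing A
  let e := WithCStarModule.equiv A (Fin k → A)
  let M := CStarMatrix.ofMatrix (coeffMatrix a x)
  -- The test vector is the scalar row `v` viewed in `A^k`; matrices act on rows from the right.
  let w := e.symm fun i => v i • (1 : A)
  have hw : ‖w‖ ^ 2 ≤ ∑ i, ‖v i‖ ^ 2 := by
    rw [WithCStarModule.pi_norm_sq]
    refine (norm_sum_le _ _).trans (Finset.sum_le_sum fun i _ => ?_)
    rw [← CStarModule.norm_sq_eq A]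
    gcongr
    change ‖v i • (1 : A)‖ ≤ _
    rw [norm_smul]
    rcases subsingleton_or_nontrivial A with _ | _
    · simp [Subsingleton.elim (1 : A) 0]
    · simp
  have hMw : CStarMatrix.toCLM M w = e.symm fun j => ∑ l, (v ᵥ* a l) j • x l := by
    rw [CStarMatrix.toCLM_apply_eq_sum]
    congr 1
    ext j
    change ∑ i, v i • (1 : A) * ∑ l, a l i j • x l = _
    simp only [Finset.mul_sum, Matrix.vecMul, dotProduct, Finset.sum_smul]
    rw [Finset.sum_comm]
    simp [smul_smul, mul_comm]
  have hn : ‖CStarMatrix.toCLM M w‖ ^ 2 =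
      ‖∑ j, (∑ l, (v ᵥ* a l) j • x l) * star (∑ l, (v ᵥ* a l) j • x l)‖ := by
    rw [hMw, WithCStarModule.pi_norm_sq]
    rfl
  -- Orthonormality removes the terms with `l ≠ m`, leaving the sum of squares to be bounded.
  have hφs : φ (∑ j, (∑ l, (v ᵥ* a l) j • x l) * star (∑ l, (v ᵥ* a l) j • x l)) =
      ((∑ l, ∑ j, ‖(v ᵥ* a l) j‖ ^ 2 : ℝ) : ℂ) := by
    rw [Finset.sum_comm, map_sum]
    push_cast
    refine Finset.sum_congr rfl fun j _ => ?_
    simp only [star_sum, star_smul, Finset.sum_mul_sum, map_sum, smul_mul_smul_comm, map_smul, hx,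
      smul_eq_mul, mul_ite, mul_one, mul_zero, Finset.sum_ite_eq, Finset.mem_univ, if_true]
    exact Finset.sum_congr rfl fun l _ => Complex.mul_conj' _
  calc ∑ l, ∑ j, ‖(v ᵥ* a l) j‖ ^ 2 = ‖((∑ l, ∑ j, ‖(v ᵥ* a l) j‖ ^ 2 : ℝ) : ℂ)‖ := by
        rw [Complex.norm_real, Real.norm_of_nonneg (by positivity)]
    _ ≤ ‖CStarMatrix.toCLM M w‖ ^ 2 := by
        rw [← hφs, hn]
        exact hφ _
    _ ≤ (matrixNorm (coeffMatrix a x) * ‖w‖) ^ 2 := by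
        gcongr
        exact (CStarMatrix.toCLM M).le_opNorm w
    _ ≤ _ := by
        rw [mul_pow]
        gcongr

/-- The hypothesis says that `v ↦ (v ᵥ* a l)_l` has norm at most `C`. With `T` this map, `∑ (a l) (a
l)^*` acts on rows as `T^* T`, so its norm is at most `C²`. -/
theorem norm_sum_mul_star_le (a : ι → Matrix (Fin k) (Fin k) ℂ) {C : ℝ} (hC : 0 ≤ C)
    (h : ∀ v : Fin k → ℂ, ∑ l, ∑ j, ‖(v ᵥ* a l) j‖ ^ 2 ≤ C ^ 2 * ∑ i, ‖v i‖ ^ 2) :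
    ‖∑ l, CStarMatrix.ofMatrix (a l) * star (CStarMatrix.ofMatrix (a l))‖ ≤ C ^ 2 := by
  have hnorm : ∀ v : WithCStarModule ℂ (Fin k → ℂ), ‖v‖ ^ 2 = ∑ i, ‖v i‖ ^ 2 := fun v => by
    rw [WithCStarModule.pi_norm_sq]
    have : ∑ i, inner ℂ (v i) (v i) = ((∑ i, ‖v i‖ ^ 2 : ℝ) : ℂ) := by
      push_cast
      exact Finset.sum_congr rfl fun i _ => Complex.mul_conj' _
    rw [this, Complex.norm_real, Real.norm_of_nonneg (by positivity)]
  have hrow : ∀ v : WithCStarModule ℂ (Fin k → ℂ),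
      √(∑ l, ‖CStarMatrix.toCLM (CStarMatrix.ofMatrix (a l)) v‖ ^ 2) ≤ C * ‖v‖ := fun v => by
    refine Real.sqrt_le_iff.2 ⟨by positivity, ?_⟩
    rw [mul_pow, hnorm]
    simp only [hnorm]
    exact h v
  refine CStarMatrix.norm_le_of_forall_inner_le (C := ⟨C ^ 2, sq_nonneg C⟩) fun v w => ?_
  -- Acting on rows reverses products: `a l` is applied first and its adjoint second.
  have hS : CStarMatrix.toCLM
      (∑ l, CStarMatrix.ofMatrix (a l) * star (CStarMatrix.ofMatrix (a l))) v =
      ∑ l, CStarMatrix.toCLM (CStarMatrix.ofMatrix (a l))ᴴ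
        (CStarMatrix.toCLM (CStarMatrix.ofMatrix (a l)) v) := by
    rw [map_sum, sum_apply]
    refine Finset.sum_congr rfl fun l _ => ?_
    simp only [CStarMatrix.toCLM_apply]
    exact congrArg (WithCStarModule.equiv ℂ (Fin k → ℂ)).symm (Matrix.vecMul_vecMul _ _ _).symm
  rw [hS, CStarModule.inner_sum_right]
  -- Each adjoint moves to the other side of the inner product; Cauchy–Schwarz is then used for each
  -- `l` and once more for the sum over `l`.
  calc _ ≤ ∑ l, ‖CStarMatrix.toCLM (CStarMatrix.ofMatrix (a l)) w‖ *
          ‖CStarMatrix.toCLM (CStarMatrix.ofMatrix (a l)) v‖ := by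
        refine (norm_sum_le _ _).trans (Finset.sum_le_sum fun l _ => ?_)
        rw [CStarMatrix.inner_toCLM_conjTranspose_right]
        exact CStarModule.norm_inner_le _
    _ ≤ _ := Real.sum_mul_le_sqrt_mul_sqrt _ _ _
    _ ≤ (C * ‖w‖) * (C * ‖v‖) :=
        mul_le_mul (hrow w) (hrow v) (Real.sqrt_nonneg _) (by positivity)
    _ = _ := by
        change _ = C ^ 2 * _ * _
        ring

end MatrixNorm

/-! ### Homomorphisms out of group algebras -/

section GroupAlgebraHom

variable {G : Type u} [Group G]

/-- The `*`-homomorphism of the group algebra that extends a unitary representation. -/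
def groupAlgebraLift {C : Type*} [Ring C] [StarRing C] [Algebra ℂ C] [StarModule ℂ C]
    (U : G →* unitary C) : MonoidAlgebra ℂ G →⋆ₐ[ℂ] C :=
  { MonoidAlgebra.lift ℂ C G ((unitary C).subtype.comp U) with
    map_star' := fun x => by
      change MonoidAlgebra.lift ℂ C G ((unitary C).subtype.comp U) (star x) =
        star (MonoidAlgebra.lift ℂ C G ((unitary C).subtype.comp U) x)
      induction x using MonoidAlgebra.induction_linear with
      | zero => simp
      | add x y hx hy => rw [star_add, map_add, map_add, star_add, hx, hy]
      | single g c => simp [groupAlgebra_star_single, ← Unitary.star_eq_inv] }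

theorem groupAlgebraLift_single {C : Type*} [Ring C] [StarRing C] [Algebra ℂ C] [StarModule ℂ C]
    (U : G →* unitary C) (g : G) : groupAlgebraLift U (MonoidAlgebra.single g 1) = U g := by
  change MonoidAlgebra.lift ℂ C G ((unitary C).subtype.comp U) _ = _
  simp

theorem FullGroupCStar.of_mem_unitary (g : G) :
    FullGroupCStar.of g ∈ unitary (FullGroupCStar G) := by
  have h : (MonoidAlgebra.single g (1 : ℂ)) ∈ unitary (MonoidAlgebra ℂ G) := by
    rw [Unitary.mem_iff, groupAlgebra_star_single]
    simp [MonoidAlgebra.single_mul_single, MonoidAlgebra.one_def]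
  exact Unitary.map_mem (CStarEnvelope.ι Set.univ) h

/-- A unitary representation of `G` on a Hilbert space, extended to the full C*-algebra. -/
def FullGroupCStar.rep {H : Type u} [NormedAddCommGroup H] [InnerProductSpace ℂ H]
    [CompleteSpace H] (U : G →* unitary (H →L[ℂ] H)) : StarRep (FullGroupCStar G) where
  H := H
  π := CStarEnvelope.lift (groupAlgebraLift U) fun a =>
    StarRep.le_supNorm Set.univ ⟨⟨H, groupAlgebraLift U⟩, trivial⟩ a

theorem FullGroupCStar.rep_of {H : Type u} [NormedAddCommGroup H] [InnerProductSpace ℂ H]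
    [CompleteSpace H] (U : G →* unitary (H →L[ℂ] H)) (g : G) :
    (FullGroupCStar.rep U).π (FullGroupCStar.of g) = (U g : H →L[ℂ] H) :=
  (CStarEnvelope.lift_ι (groupAlgebraLift U) (fun a =>
    StarRep.le_supNorm Set.univ ⟨⟨H, groupAlgebraLift U⟩, trivial⟩ a) _).trans
    (groupAlgebraLift_single U g)

end GroupAlgebraHom

/-! ### Vector functionals -/

section VectorFunctional

variable {A : Type u} [CStarAlgebra A] {ι : Type*}

/-- `x` is orthonormal for some contractive functional, in the sense of
`(a, b) ↦ φ (a b^*)`. -/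
def IsFunctionalOrthonormal [DecidableEq ι] (x : ι → A) : Prop :=
  ∃ φ : A →ₗ[ℂ] ℂ, (∀ b, ‖φ b‖ ≤ ‖b‖) ∧ ∀ l m, φ (x l * star (x m)) = if l = m then 1 else 0

/-- The functional is the vector state `b ↦ ⟨ξ, π(b) ξ⟩`: its value at `x_l x_m^*` is `⟨π(x_l^*) ξ,
π(x_m^*) ξ⟩`, hence the stars in the hypothesis. -/
theorem IsFunctionalOrthonormal.of_rep [DecidableEq ι] {H : Type*} [NormedAddCommGroup H]
    [InnerProductSpace ℂ H] [CompleteSpace H] (π : A →⋆ₐ[ℂ] (H →L[ℂ] H)) {x : ι → A} {ξ : H}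
    (hξ : ‖ξ‖ = 1) (hx : Orthonormal ℂ fun l => π (star (x l)) ξ) : IsFunctionalOrthonormal x := by
  refine ⟨(innerSL ℂ ξ).toLinearMap ∘ₗ (ContinuousLinearMap.apply ℂ H ξ).toLinearMap ∘ₗ
    π.toAlgHom.toLinearMap, fun b => ?_, fun l m => ?_⟩
  · change ‖inner ℂ ξ (π b ξ)‖ ≤ ‖b‖
    calc ‖inner ℂ ξ (π b ξ)‖ ≤ ‖ξ‖ * ‖π b ξ‖ := norm_inner_le_norm _ _
      _ ≤ ‖ξ‖ * (‖π b‖ * ‖ξ‖) := by gcongr; exact (π b).le_opNorm ξ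
      _ = ‖π b‖ := by rw [hξ]; ring
      _ ≤ ‖b‖ := NonUnitalStarAlgHom.norm_apply_le π b
  · change inner ℂ ξ (π (x l * star (x m)) ξ) = _
    rw [← orthonormal_iff_ite.1 hx l m, map_mul, mul_apply_eq_comp, map_star π (x l),
      ContinuousLinearMap.star_eq_adjoint, ContinuousLinearMap.adjoint_inner_left]

/-- The functional `b ↦ φ (b * star (x m))` reads off the `m`-th coefficient. -/
theorem IsFunctionalOrthonormal.linearIndependent [DecidableEq ι] [Fintype ι] {x : ι → A}
    (hx : IsFunctionalOrthonormal x) : LinearIndependent ℂ x := by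
  obtain ⟨φ, -, hφ⟩ := hx
  rw [Fintype.linearIndependent_iff]
  intro c hc m
  have h : φ ((∑ l, c l • x l) * star (x m)) = c m := by
    simp [Finset.sum_mul, map_sum, hφ]
  rw [← h, hc, zero_mul, map_zero]

theorem IsFunctionalOrthonormal.comp {κ : Type*} [DecidableEq ι] [DecidableEq κ] {x : ι → A}
    (hx : IsFunctionalOrthonormal x) {e : κ → ι} (he : Function.Injective e) :
    IsFunctionalOrthonormal (x ∘ e) := by
  obtain ⟨φ, h1, h2⟩ := hx
  exact ⟨φ, h1, fun l m => by simp [h2, he.eq_iff]⟩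

/-- The operator space structure of the span of unitaries that are orthonormal for a contractive
functional is determined up to the square root of the dimension. -/
theorem matrixNorm_coeffMatrix_le_sqrt_mul {B : Type u} [CStarAlgebra B] [DecidableEq ι]
    [Fintype ι] {k : ℕ} (a : ι → Matrix (Fin k) (Fin k) ℂ) {x : ι → A} {y : ι → B}
    (hx : ∀ l, x l * star (x l) = 1) (hy : IsFunctionalOrthonormal y) :
    matrixNorm (coeffMatrix a x) ≤ √(Fintype.card ι) * matrixNorm (coeffMatrix a y) := by
  obtain ⟨φ, h1, h2⟩ := hy
  have h := norm_sum_mul_star_le a (matrixNorm_nonneg (coeffMatrix a y))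
    (sum_norm_sq_vecMul_le a y φ h1 h2)
  refine (sq_le_sq₀ (matrixNorm_nonneg _)
    (mul_nonneg (Real.sqrt_nonneg _) (matrixNorm_nonneg _))).1 ?_
  rw [mul_pow, Real.sq_sqrt (Nat.cast_nonneg _)]
  exact (matrixNorm_coeffMatrix_sq_le a x hx).trans (by gcongr)

end VectorFunctional

/-! ### The unit and the generators of `C*(F_m)` -/

section FreeGenerators

theorem freeGen_mem_unitary {m : ℕ} (i : Fin m) : freeGen i ∈ unitary (CStarFree m) :=
  FullGroupCStar.of_mem_unitary _

/-- The unit and the generators of `C*(F_m)`. -/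
def unitGen {m : ℕ} (o : Option (Fin m)) : CStarFree m := o.elim 1 freeGen

theorem unitGen_mem_unitary {m : ℕ} (o : Option (Fin m)) : unitGen o ∈ unitary (CStarFree m) := by
  cases o with
  | none => exact one_mem _
  | some i => exact freeGen_mem_unitary i

/-- The representation in which the `i`-th generator acts on `ℓ²(ℤ/(m+1))` as the translation by
`i + 1` sends a unit vector to an orthonormal family under the unit and the generators. -/
theorem exists_rep_orthonormal_unitGen (m : ℕ) : ∃ (ρ : StarRep (CStarFree m)) (ξ : ρ.H),
    ‖ξ‖ = 1 ∧ Orthonormal ℂ fun o : Option (Fin m) => ρ.π (star (unitGen o)) ξ := by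
  -- There is one point for the unit and one for each generator. Freeness of the group allows any
  -- choice of unitaries for the generators.
  let H := EuclideanSpace ℂ (Fin (m + 1))
  let T : Fin m → (H ≃ₗᵢ[ℂ] H) := fun i =>
    LinearIsometryEquiv.piLpCongrLeft 2 ℂ ℂ (Equiv.addRight i.succ)
  let U : FreeGroup (Fin m) →* unitary (H →L[ℂ] H) :=
    FreeGroup.lift fun i => Unitary.linearIsometryEquiv.symm (T i)
  let ξ : H := EuclideanSpace.single 0 1
  refine ⟨FullGroupCStar.rep U, ξ, (PiLp.norm_single 2 (fun _ => ℂ) 0 (1 : ℂ)).trans norm_one, ?_⟩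
  -- `finSuccEquiv` sends `0` to `none` and `i + 1` to `some i`, so one formula covers both cases;
  -- the sign appears because the adjoint translates backwards.
  have h : ∀ o : Option (Fin m), (FullGroupCStar.rep U).π (star (unitGen o)) ξ =
      (EuclideanSpace.single (-((finSuccEquiv m).symm o)) (1 : ℂ) : H) := by
    rintro (_ | i)
    · change (FullGroupCStar.rep U).π (star 1) ξ = _
      rw [star_one, map_one]
      simp [ξ]
      rfl
    · change (FullGroupCStar.rep U).π (star (FullGroupCStar.of _)) ξ = _
      rw [map_star, FullGroupCStar.rep_of]
      change ((star (U (FreeGroup.of i)) : unitary (H →L[ℂ] H)) : H →L[ℂ] H) ξ = _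
      rw [Unitary.star_eq_inv, FreeGroup.lift_apply_of, ← map_inv]
      change (T i).symm (EuclideanSpace.single 0 1) = _
      rw [show (T i).symm = LinearIsometryEquiv.piLpCongrLeft 2 ℂ ℂ (Equiv.addRight i.succ).symm
        from LinearIsometryEquiv.piLpCongrLeft_symm _, EuclideanSpace.piLpCongrLeft_single,
        Equiv.addRight_symm, Equiv.coe_addRight, finSuccEquiv_symm_some]
      exact congrArg (EuclideanSpace.single · (1 : ℂ)) (zero_add _)
  simp only [h]
  exact (EuclideanSpace.orthonormal_single).comp (fun o => -((finSuccEquiv m).symm o))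
    (neg_injective.comp (finSuccEquiv m).symm.injective)

theorem isFunctionalOrthonormal_unitGen (m : ℕ) :
    IsFunctionalOrthonormal (unitGen : Option (Fin m) → CStarFree m) := by
  obtain ⟨ρ, ξ, hξ, h⟩ := exists_rep_orthonormal_unitGen m
  exact .of_rep ρ.π hξ h

end FreeGenerators

/-! ### The generating families -/

section Families

variable {n : ℕ}

/-- The family `1 ⊗ 1`, `V_i ⊗ 1`, `1 ⊗ V_i`. -/
def tensorGen (l : Option (Fin n ⊕ Fin n)) : CStarFree n ⊗[ℂ] CStarFree n :=
  unitGen (l.bind (Sum.elim some fun _ => none)) ⊗ₜ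
    unitGen (l.bind (Sum.elim (fun _ => none) some))

/-- The family `1, W_1, …, W_{2n}`, with the generators split into two halves. -/
def splitGen (l : Option (Fin n ⊕ Fin n)) : CStarFree (2 * n) :=
  unitGen (l.map (finSumFinEquiv.trans (finCongr (two_mul n).symm)))

theorem tensorGen_mem_unitary (l : Option (Fin n ⊕ Fin n)) :
    tensorGen l ∈ unitary (CStarFree n ⊗[ℂ] CStarFree n) := by
  rw [Unitary.mem_iff, tensorGen, TensorProduct.star_tmul, Algebra.TensorProduct.tmul_mul_tmul,
    Algebra.TensorProduct.tmul_mul_tmul]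
  simp [(Unitary.mem_iff.1 (unitGen_mem_unitary _)).1,
    (Unitary.mem_iff.1 (unitGen_mem_unitary _)).2, Algebra.TensorProduct.one_def]

theorem isFunctionalOrthonormal_splitGen :
    IsFunctionalOrthonormal (splitGen : Option (Fin n ⊕ Fin n) → CStarFree (2 * n)) :=
  (isFunctionalOrthonormal_unitGen (2 * n)).comp (Option.map_injective (Equiv.injective _))

/-- The representation `ρ ⊗ ρ` is one of those defining the minimal norm, so it extends to the
completion; the vector `ξ ⊗ ξ` inherits orthonormality from the two legs. -/
theorem isFunctionalOrthonormal_toMin_tensorGen :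
    IsFunctionalOrthonormal fun l : Option (Fin n ⊕ Fin n) => toMin n (tensorGen l) := by
  obtain ⟨ρ, ξ, hξ, h⟩ := exists_rep_orthonormal_unitGen n
  let π : MinTensor (CStarFree n) (CStarFree n) →⋆ₐ[ℂ]
      (HilbertTensor ρ.H ρ.H →L[ℂ] HilbertTensor ρ.H ρ.H) :=
    CStarEnvelope.lift (ρ.tensor ρ).π fun a =>
      StarRep.le_supNorm (Set.range fun p : StarRep (CStarFree n) × StarRep (CStarFree n) =>
        p.1.tensor p.2) ⟨ρ.tensor ρ, (ρ, ρ), rfl⟩ a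
  have hπ : ∀ l : Option (Fin n ⊕ Fin n),
      π (star (toMin n (tensorGen l))) (HilbertTensor.coe (ξ ⊗ₜ ξ)) = HilbertTensor.coe
        (ρ.π (star (unitGen (l.bind (Sum.elim some fun _ => none)))) ξ ⊗ₜ
          ρ.π (star (unitGen (l.bind (Sum.elim (fun _ => none) some)))) ξ) := fun l => by
    rw [← map_star]
    have : π (toMin n (star (tensorGen l))) = (ρ.tensor ρ).π (star (tensorGen l)) :=
      CStarEnvelope.lift_ι _ _ _
    rw [this, tensorGen, TensorProduct.star_tmul]
    exact hilbertTensorMap_tmul _ _ _ _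
  refine .of_rep π (ξ := HilbertTensor.coe (ξ ⊗ₜ ξ)) ?_ ?_
  · rw [LinearIsometry.norm_map, TensorProduct.norm_tmul, hξ, mul_one]
  · simp only [hπ]
    rw [orthonormal_iff_ite] at h ⊢
    -- Inner products factor over the legs, and two different indices differ in at least one leg,
    -- where the factor vanishes.
    intro l m
    rw [LinearIsometry.inner_map_map, TensorProduct.inner_tmul, h, h]
    rcases l with _ | _ | _ <;> rcases m with _ | _ | _ <;> simp

theorem genSpace_eq_span : genSpace n = Submodule.span ℂ (Set.range (tensorGen (n := n))) := by
  rw [genSpace]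
  congr 1
  ext y
  simp only [Set.mem_union, Set.mem_singleton_iff, Set.mem_range]
  constructor
  · rintro ((rfl | ⟨i, rfl⟩) | ⟨i, rfl⟩)
    · exact ⟨none, rfl⟩
    · exact ⟨some (.inl i), rfl⟩
    · exact ⟨some (.inr i), rfl⟩
  · rintro ⟨_ | i | i, rfl⟩
    · exact .inl (.inl rfl)
    · exact .inl (.inr ⟨i, rfl⟩)
    · exact .inr ⟨i, rfl⟩

theorem freeGenSpace_eq_span :
    freeGenSpace n = Submodule.span ℂ (Set.range (splitGen (n := n))) := by
  rw [freeGenSpace]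
  congr 1
  ext y
  simp only [Set.mem_union, Set.mem_singleton_iff, Set.mem_range]
  constructor
  · rintro (rfl | ⟨i, rfl⟩)
    · exact ⟨none, rfl⟩
    · exact ⟨some ((finSumFinEquiv.trans (finCongr (two_mul n).symm)).symm i), by
        simp [splitGen, unitGen]⟩
  · rintro ⟨_ | i, rfl⟩
    · exact .inl rfl
    · exact .inr ⟨_, rfl⟩

/-- Independence is inherited from the images in the minimal tensor product. -/
theorem linearIndependent_tensorGen : LinearIndependent ℂ (tensorGen (n := n)) :=
  .of_comp (toMin n).toAlgHom.toLinearMap isFunctionalOrthonormal_toMin_tensorGen.linearIndependent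

theorem finrank_genSpace : Module.finrank ℂ (genSpace n) = 2 * n + 1 := by
  rw [genSpace_eq_span, finrank_span_eq_card linearIndependent_tensorGen]
  simp [two_mul]

theorem tensorGen_mem (l : Option (Fin n ⊕ Fin n)) : tensorGen l ∈ genSpace n := by
  rw [genSpace_eq_span]
  exact Submodule.subset_span ⟨l, rfl⟩

theorem exists_coeffMatrix_eq {k : ℕ} (X : Matrix (Fin k) (Fin k) (genSpace n)) :
    ∃ a, X = coeffMatrix a fun l => (⟨tensorGen l, tensorGen_mem l⟩ : genSpace n) := by
  have h : ∀ y : genSpace n, ∃ c : Option (Fin n ⊕ Fin n) → ℂ,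
      y = ∑ l, c l • (⟨tensorGen l, tensorGen_mem l⟩ : genSpace n) := fun ⟨y, hy⟩ => by
    have hy' := hy
    rw [genSpace_eq_span, Submodule.mem_span_range_iff_exists_fun] at hy'
    obtain ⟨c, rfl⟩ := hy'
    exact ⟨c, Subtype.ext (by simp)⟩
  choose c hc using h
  exact ⟨fun l => Matrix.of fun i j => c (X i j) l, by ext1 i j; exact hc (X i j)⟩

end Families

theorem exists_linearEquiv_span {V W ι : Type*} [AddCommGroup V] [Module ℂ V] [AddCommGroup W]
    [Module ℂ W] {x : ι → V} {w : ι → W} (hx : LinearIndependent ℂ x) (hw : LinearIndependent ℂ w)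
    {E : Submodule ℂ V} {F : Submodule ℂ W} (hE : E = Submodule.span ℂ (Set.range x))
    (hF : F = Submodule.span ℂ (Set.range w)) :
    ∃ Φ : E ≃ₗ[ℂ] F, ∀ l (h : x l ∈ E), (Φ ⟨x l, h⟩ : W) = w l := by
  subst hE hF
  refine ⟨hx.linearCombinationEquiv.symm.trans hw.linearCombinationEquiv, fun l h => ?_⟩
  have : hx.linearCombinationEquiv.symm ⟨x l, h⟩ = Finsupp.single l 1 := by
    rw [LinearEquiv.symm_apply_eq]
    ext
    simp
  simp [this]

/-! ### Comparison of the norms -/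

section Comparison

variable {n k : ℕ}

/-- The canonical quotient map from the maximal to the minimal tensor product. -/
def maxToMin (A B : Type u) [CStarAlgebra A] [CStarAlgebra B] :
    MaxTensor A B →⋆ₐ[ℂ] MinTensor A B :=
  CStarEnvelope.lift (CStarEnvelope.ι _) fun a => by
    refine (CStarEnvelope.norm_coe _ a).trans_le
      (StarRep.supNorm_le _ (StarRep.supNorm_nonneg _ _) fun ρ => ?_)
    -- The minimal norm is a supremum over fewer representations than the maximal one.
    exact StarRep.le_supNorm Set.univ ⟨ρ.1, trivial⟩ a

theorem maxToMin_toMax (y : CStarFree n ⊗[ℂ] CStarFree n) :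
    maxToMin _ _ (toMax n y) = toMin n y :=
  CStarEnvelope.lift_ι _ _ _

theorem normMin_le_normMax (X : Matrix (Fin k) (Fin k) (genSpace n)) : normMin X ≤ normMax X := by
  refine le_of_eq_of_le ?_ (matrixNorm_map_le (maxToMin _ _) _)
  rw [normMin, Matrix.map_map]
  congr 2
  ext1 x
  exact (maxToMin_toMax _).symm

variable (n) in
/-- The `*`-homomorphism `ℂ[F_{2n}] → C*(F_n) ⊗ C*(F_n)` with `W_i ↦ V_i ⊗ 1` and
`W_{n+i} ↦ 1 ⊗ V_i`. -/
def groupAlgebraToTensor :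
    MonoidAlgebra ℂ (FreeGroup (Fin (2 * n))) →⋆ₐ[ℂ] CStarFree n ⊗[ℂ] CStarFree n :=
  groupAlgebraLift <| FreeGroup.lift fun i =>
    ⟨tensorGen (some ((finSumFinEquiv.trans (finCongr (two_mul n).symm)).symm i)),
      tensorGen_mem_unitary _⟩

variable (n) in
/-- The `*`-homomorphism `C*(F_{2n}) → C*(F_n) ⊗_max C*(F_n)` with `W_i ↦ V_i ⊗ 1` and
`W_{n+i} ↦ 1 ⊗ V_i`. -/
def freeToMax : CStarFree (2 * n) →⋆ₐ[ℂ] MaxTensor (CStarFree n) (CStarFree n) :=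
  CStarEnvelope.lift ((toMax n).comp (groupAlgebraToTensor n)) fun a => by
    refine (CStarEnvelope.norm_coe _ _).trans_le
      (StarRep.supNorm_le _ (StarRep.supNorm_nonneg _ _) fun ρ => ?_)
    -- A representation of the tensor product, pulled back to `ℂ[F_{2n}]`, is among those defining
    -- the norm of `C*(F_{2n})`.
    exact StarRep.le_supNorm Set.univ ⟨⟨ρ.1.H, ρ.1.π.comp (groupAlgebraToTensor n)⟩, trivial⟩ a

theorem freeToMax_splitGen (l : Option (Fin n ⊕ Fin n)) :
    freeToMax n (splitGen l) = toMax n (tensorGen l) := by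
  rcases l with _ | l
  · exact (map_one _).trans (map_one (toMax n)).symm
  · refine (CStarEnvelope.lift_ι _ _ _).trans (congrArg (toMax n) ?_)
    refine (groupAlgebraLift_single _ _).trans ?_
    simp

/-- The identification of `𝒳` with the span of the unit and the generators of `C*(F_{2n})`. -/
theorem exists_isGenIdentification : ∃ Φ : genSpace n ≃ₗ[ℂ] freeGenSpace n,
    IsGenIdentification Φ ∧ ∀ l, (Φ ⟨tensorGen l, tensorGen_mem l⟩ : CStarFree (2 * n)) =
      splitGen l := by
  obtain ⟨Φ, hΦ⟩ := exists_linearEquiv_span linearIndependent_tensorGen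
    isFunctionalOrthonormal_splitGen.linearIndependent (genSpace_eq_span (n := n))
    freeGenSpace_eq_span
  -- The `Option`-indexed families unfold definitionally to the named generators, including the
  -- shift by `n` on the second half.
  exact ⟨Φ, ⟨hΦ none _, fun i => hΦ (some (.inl i)) _, fun i => hΦ (some (.inr i)) _⟩,
    fun l => hΦ l _⟩

theorem normMin_coeffMatrix (a : Option (Fin n ⊕ Fin n) → Matrix (Fin k) (Fin k) ℂ) :
    normMin (coeffMatrix a fun l => (⟨tensorGen l, tensorGen_mem l⟩ : genSpace n)) =
      matrixNorm (coeffMatrix a fun l => toMin n (tensorGen l)) :=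
  congrArg matrixNorm (coeffMatrix_map a _
    ((toMin n).toAlgHom.toLinearMap ∘ₗ (genSpace n).subtype))

theorem normMax_coeffMatrix (a : Option (Fin n ⊕ Fin n) → Matrix (Fin k) (Fin k) ℂ) :
    normMax (coeffMatrix a fun l => (⟨tensorGen l, tensorGen_mem l⟩ : genSpace n)) =
      matrixNorm (coeffMatrix a fun l => toMax n (tensorGen l)) :=
  congrArg matrixNorm (coeffMatrix_map a _
    ((toMax n).toAlgHom.toLinearMap ∘ₗ (genSpace n).subtype))

variable {Φ : genSpace n ≃ₗ[ℂ] freeGenSpace n}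

theorem normFree_coeffMatrix
    (hΦ : ∀ l, (Φ ⟨tensorGen l, tensorGen_mem l⟩ : CStarFree (2 * n)) = splitGen l)
    (a : Option (Fin n ⊕ Fin n) → Matrix (Fin k) (Fin k) ℂ) :
    normFree Φ (coeffMatrix a fun l => (⟨tensorGen l, tensorGen_mem l⟩ : genSpace n)) =
      matrixNorm (coeffMatrix a (splitGen (n := n))) := by
  rw [← funext hΦ]
  exact congrArg matrixNorm (coeffMatrix_map a _
    ((freeGenSpace n).subtype ∘ₗ Φ.toLinearMap))

theorem normMax_le_normFree
    (hΦ : ∀ l, (Φ ⟨tensorGen l, tensorGen_mem l⟩ : CStarFree (2 * n)) = splitGen l)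
    (X : Matrix (Fin k) (Fin k) (genSpace n)) : normMax X ≤ normFree Φ X := by
  obtain ⟨a, rfl⟩ := exists_coeffMatrix_eq X
  rw [normMax_coeffMatrix, normFree_coeffMatrix hΦ]
  refine le_of_eq_of_le (congrArg matrixNorm ?_) (matrixNorm_map_le (freeToMax n) _)
  simp only [← freeToMax_splitGen]
  exact (coeffMatrix_map a _ (freeToMax n).toAlgHom.toLinearMap).symm

/-- Only two facts enter: the free generators are unitaries, and the generators in the minimal
tensor product are orthonormal for a contractive functional. The constant is the square root of the
number `2n + 1` of generators, unit included. -/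
theorem normFree_le_mul_normMin
    (hΦ : ∀ l, (Φ ⟨tensorGen l, tensorGen_mem l⟩ : CStarFree (2 * n)) = splitGen l)
    (X : Matrix (Fin k) (Fin k) (genSpace n)) :
    normFree Φ X ≤ √(2 * n + 1 : ℕ) * normMin X := by
  obtain ⟨a, rfl⟩ := exists_coeffMatrix_eq X
  rw [normMin_coeffMatrix, normFree_coeffMatrix hΦ]
  refine (matrixNorm_coeffMatrix_le_sqrt_mul a
    (fun l => (Unitary.mem_iff.1 (unitGen_mem_unitary _)).2)
    isFunctionalOrthonormal_toMin_tensorGen).trans_eq ?_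
  simp [two_mul]

end Comparison

/-! ### The completely bounded distance -/

section CbDist

variable {n : ℕ}

theorem cbNorm_le {A B : Type u} [CStarAlgebra A] [CStarAlgebra B] {E : Submodule ℂ A}
    {F : Submodule ℂ B} {u : E →ₗ[ℂ] F} {C : ℝ} (hC : 0 ≤ C)
    (h : ∀ (k : ℕ) (X : Matrix (Fin k) (Fin k) E),
      matrixNorm (X.map fun x => (u x : B)) ≤ C * matrixNorm (X.map fun x => (x : A))) :
    cbNorm u ≤ ENNReal.ofReal C :=
  iSup_le fun k => iSup_le fun X => iSup_le fun hX =>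
    ENNReal.ofReal_le_ofReal ((h k X).trans (mul_le_of_le_one_right hC hX))

theorem exists_linearEquiv_map {V W : Type*} [AddCommGroup V] [Module ℂ V] [AddCommGroup W]
    [Module ℂ W] (E : Submodule ℂ V) (f : V →ₗ[ℂ] W) (hf : Set.InjOn f E) :
    ∃ Θ : E ≃ₗ[ℂ] E.map f, ∀ x, (Θ x : W) = f x :=
  ⟨(LinearEquiv.ofInjective (f.domRestrict E) hf.injective).trans
    (LinearEquiv.ofEq _ _ (LinearMap.range_domRestrict E f)), fun _ => rfl⟩

theorem injOn_toMin : Set.InjOn (toMin n).toAlgHom.toLinearMap (genSpace n) := by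
  rw [genSpace_eq_span, ← LinearMap.disjoint_ker_iff_injOn]
  exact Submodule.range_ker_disjoint
    isFunctionalOrthonormal_toMin_tensorGen.linearIndependent

/-- The map to the minimal tensor product factors through the maximal one and is already injective
on `𝒳`. -/
theorem injOn_toMax : Set.InjOn (toMax n).toAlgHom.toLinearMap (genSpace n) :=
  fun x hx y hy h => injOn_toMin hx hy <| by
    change toMin n x = toMin n y
    rw [← maxToMin_toMax, ← maxToMin_toMax]
    exact congrArg (maxToMin _ _) h

theorem cbDist_genSpaceMax_genSpaceMin_le {C : ℝ} (hC : 0 ≤ C)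
    (h : ∀ (k : ℕ) (X : Matrix (Fin k) (Fin k) (genSpace n)), normMax X ≤ C * normMin X) :
    cbDist (genSpaceMax n) (genSpaceMin n) ≤ ENNReal.ofReal C := by
  obtain ⟨P, hP⟩ := exists_linearEquiv_map (genSpace n) _ injOn_toMax
  obtain ⟨Q, hQ⟩ := exists_linearEquiv_map (genSpace n) _ injOn_toMin
  -- The competitor is the identity of `𝒳`, read from its maximal image to its minimal one: it is
  -- completely contractive, and its inverse has cb norm at most `C`.
  refine (iInf_le _ (P.symm.trans Q)).trans ?_
  have h1 : cbNorm (P.symm.trans Q).toLinearMap ≤ ENNReal.ofReal 1 := by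
    refine cbNorm_le zero_le_one fun k X => ?_
    rw [one_mul]
    obtain ⟨Y, rfl⟩ : ∃ Y : Matrix (Fin k) (Fin k) (genSpace n), X = Y.map P :=
      ⟨X.map P.symm, by ext; simp⟩
    simpa [Matrix.map_map, Function.comp_def, hP, hQ, normMin, normMax] using normMin_le_normMax Y
  have h2 : cbNorm (P.symm.trans Q).symm.toLinearMap ≤ ENNReal.ofReal C := by
    refine cbNorm_le hC fun k X => ?_
    obtain ⟨Y, rfl⟩ : ∃ Y : Matrix (Fin k) (Fin k) (genSpace n), X = Y.map Q :=
      ⟨X.map Q.symm, by ext; simp⟩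
    simpa [Matrix.map_map, Function.comp_def, hP, hQ, normMin, normMax] using h k Y
  calc _ ≤ ENNReal.ofReal 1 * ENNReal.ofReal C := mul_le_mul' h1 h2
    _ = _ := by simp

end CbDist

end

/-! ### Assembling the estimates -/

theorem mainTheorem1 (n N : ℕ) (hn : 2 ≤ n) (hN : N = 2 * n + 1) :
    Module.finrank ℂ (genSpace n) = N ∧
    (∃ Φ : genSpace n ≃ₗ[ℂ] freeGenSpace n, IsGenIdentification Φ ∧
      ∀ k : ℕ, 1 ≤ k → ∀ X : Matrix (Fin k) (Fin k) (genSpace n),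
        normMin X ≤ normMax X ∧
        normMax X ≤ normFree Φ X ∧
        normFree Φ X ≤ Real.sqrt ((N : ℝ) ^ 2 - N) * normMin X) ∧
    cbDist (genSpaceMax n) (genSpaceMin n) ≤ ENNReal.ofReal (Real.sqrt ((N : ℝ) ^ 2 - N)) := by
  subst hN
  obtain ⟨Φ, hgen, hΦ⟩ := exists_isGenIdentification (n := n)
  -- The argument yields the constant `√N`; `N ≤ N² - N` holds as soon as `N ≥ 2`.
  have hsqrt : √((2 * n + 1 : ℕ) : ℝ) ≤ √(((2 * n + 1 : ℕ) : ℝ) ^ 2 - (2 * n + 1 : ℕ)) := by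
    refine Real.sqrt_le_sqrt ?_
    have : (2 : ℝ) ≤ n := by exact_mod_cast hn
    push_cast
    nlinarith
  -- Stated for every `k`, including `0`, because the supremum in `cbNorm` ranges over all of `ℕ`.
  have hfree : ∀ (k : ℕ) (X : Matrix (Fin k) (Fin k) (genSpace n)),
      normFree Φ X ≤ √(((2 * n + 1 : ℕ) : ℝ) ^ 2 - (2 * n + 1 : ℕ)) * normMin X := fun k X =>
    (normFree_le_mul_normMin hΦ X).trans
      (mul_le_mul_of_nonneg_right hsqrt (matrixNorm_nonneg _))
  refine ⟨finrank_genSpace, ⟨Φ, hgen, fun k _ X =>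
    ⟨normMin_le_normMax X, normMax_le_normFree hΦ X, hfree k X⟩⟩, ?_⟩
  exact cbDist_genSpaceMax_genSpaceMin_le (Real.sqrt_nonneg _) fun k X =>
    (normMax_le_normFree hΦ X).trans (hfree k X)
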